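/- Let $S$ be a positive semifield: a (not necessarily commutative) semiring such that $a+b=0$ implies $a=b=0$, and every $a\neq 0$ has a two-sided multiplicative inverse. For a set $X$ let $\mathcal S X$ be the free left $S$-semimodule of finitely supported functions $\varphi\colon X\to S$; for $f\colon X\to Y$ let $\mathcal S f(\varphi)(y)=\sum_{f(x)=y}\varphi(x)$; and let $\Delta_x\in\mathcal S X$ be the function with value $1$ at $x$ and $0$ elsewhere. A subset $A$ of a left $S$-semimodule is *convex* if it equals the set of all finite sums $\sum_i\lambda_i\cdot a_i$ with $a_i\in A$, $\lambda_i\in S$ and $\sum_i\lambda_i=1$. Let $\mathcal P_c\mathcal S$ be the monad on $\mathbf{Set}$ with $$\mathcal P_c\mathcal S X=\{A\subseteq \mathcal S X : A\text{ convex}\},\qquad \mathcal P_c\mathcal S f(A)=\{\mathcal S f(\varphi) : \varphi\in A\},\qquad \eta_X(x)=\{\Delta_x\},$$ $$\mu_X(\mathscr A)=\bigcup_{\Omega\in\mathscr A}\Big\{\sum_{A\in\operatorname{supp}\Omega}\Omega(A)\cdot u(A) \;:\; u\colon\operatorname{supp}\Omega\to\mathcal S X,\ u(A)\in A\text{ for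 all }A\Big\}.$$ Let $(\Sigma,E)$ be the infinitary algebraic theory with operations $\bigvee_I$ of arity $I$ for every set $I$, a binary operation $+$, a constant $0$, and a unary operation $\lambda\cdot{}$ for every $\lambda\in S$, and with the following equations. - Complete semilattices: $\bigvee_{i\in\{0\}}x_i=x_0$; $\ \bigvee_{j\in J}x_j=\bigvee_{i\in I}x_{f(i)}$ for every surjection $f\colon I\to J$; $\ \bigvee_{i\in I}x_i=\bigvee_{j\in J}\bigvee_{i\in f^{-1}\{j\}}x_i$ for every function $f\colon I\to J$. - Left $S$-semimodules: $(x+y)+z=x+(y+z)$, $x+y=y+x$, $x+0=x$, $\lambda\cdot 0=0$, $0_S\cdot x=0$, $1_S\cdot x=x$, $(\lambda\mu)\cdot x=\lambda\cdot(\mu\cdot x)$, $\lambda\cdot(x+y)=\lambda\cdot x+\lambda\cdot y$, $(\lambda+\mu)\cdot x=\lambda\cdot x+\mu\cdot x$. - Distributivity: (D1) $\lambda\cdot\bigvee_{i\in I}x_i=\bigvee_{i\in I}\lambda\cdot x_i$ for $\lambda\neq 0$; (D2) $\bigvee_{i\in I}x_i+\bigvee_{j\in J}y_j=\bigvee_{(i,j)\in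 I\times J}(x_i+y_j)$. Then the theory $(\Sigma,E)$ presents the monad $\mathcal P_c\mathcal S$: the category of Eilenberg–Moore algebras of $\mathcal P_c\mathcal S$ is isomorphic to the category of $(\Sigma,E)$-algebras and their homomorphisms, by an isomorphism that commutes with the forgetful functors to $\mathbf{Set}$. -/

import Mathlib

open CategoryTheory

universe u v

namespace ConvexPowerset

/-! ### Positive semifields -/

/-- A semiring `S` (not necessarily commutative) is a positive semifield if `a + b = 0` implies
`a = 0 = b`, and every nonzero element has a two-sided multiplicative inverse. -/
class PositiveSemifield (S : Type u) [Semiring S] : Prop where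
  positive : ∀ a b : S, a + b = 0 → a = 0 ∧ b = 0
  semifield : ∀ a : S, a ≠ 0 → ∃ x : S, a * x = 1 ∧ x * a = 1

/-! ### Linear combinations, convexity, choice -/

section Convexity

variable (S : Type u) [Semiring S] {M : Type v} [AddCommMonoid M] [Module S M]

/-- The structure map `a(φ) = ∑ x, φ(x) • x` of a left `S`-semimodule `M`, seen as an algebra for
the monad of finitely supported functions into `S`. For `M = X →₀ S` this is the multiplication
`Ψ ↦ (x ↦ ∑ φ, Ψ(φ) * φ(x))` of that monad. -/
noncomputable def combine (φ : M →₀ S) : M := φ.sum fun x s => s • x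

/-- The set of all combinations of elements of `A` with coefficients that add up to one. -/
def convClosure (A : Set M) : Set M :=
  {m | ∃ φ : M →₀ S, (φ.support : Set M) ⊆ A ∧ (φ.sum fun _ s => s) = 1 ∧ combine S φ = m}

/-- A subset of a semimodule is convex if it equals its convex closure. -/
def IsConvex (A : Set M) : Prop := A = convClosure S A

variable (M) in
/-- The type of convex subsets of a semimodule. -/
@[ext]
structure ConvSubset : Type v where
  carrier : Set M
  isConvex : IsConvex S carrier

/-- The set of all pushforwards of `Φ` along functions `u` that choose an element `u A ∈ A` for
every set `A` in the support of `Φ`. (The values of `u` outside the support do not matter.) -/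
def choice {X : Type v} (Φ : Set X →₀ S) : Set (X →₀ S) :=
  {φ | ∃ u : Set X → X, (∀ A ∈ Φ.support, u A ∈ A) ∧ φ = Φ.mapDomain u}

/-- The set of all `∑ A, Φ(A) • u(A)`, where `u` chooses an element `u(A) ∈ A` for every convex
set `A` in the support of `Φ`. -/
def alpha (Φ : ConvSubset S M →₀ S) : Set M :=
  combine S '' choice S (Φ.mapDomain ConvSubset.carrier)

end Convexity

/-! ### Auxiliary facts: the data of the monad are well defined and satisfy the monad laws -/

section Aux

variable {S : Type u} [Semiring S] {M : Type v} [AddCommMonoid M] [Module S M]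

theorem combine_eq (φ : M →₀ S) : combine S φ = Finsupp.linearCombination S id φ := by
  simp [combine, Finsupp.linearCombination_apply]

theorem weight_eq {X : Type v} (φ : X →₀ S) :
    (φ.sum fun _ s => s) = Finsupp.linearCombination S (fun _ => (1 : S)) φ := by
  simp [Finsupp.linearCombination_apply]

theorem subset_convClosure (A : Set M) : A ⊆ convClosure S A := by
  intro m hm
  refine ⟨Finsupp.single m 1, ?_, ?_, ?_⟩
  · intro x hx
    have := Finsupp.support_single_subset (Finset.mem_coe.1 hx)
    rw [Finset.mem_singleton] at this
    exact this ▸ hm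
  · simp [weight_eq]
  · simp [combine_eq]

theorem isConvex_of_subset {A : Set M} (h : convClosure S A ⊆ A) : IsConvex S A :=
  Set.Subset.antisymm (subset_convClosure A) h

theorem support_sum_single {ι : Type*} {X : Type v} {s : Finset ι} {c : ι → S} {x : ι → X} {y : X}
    (hy : y ∈ (∑ i ∈ s, Finsupp.single (x i) (c i)).support) :
    ∃ i ∈ s, c i ≠ 0 ∧ x i = y := by
  classical
  rw [Finsupp.mem_support_iff, Finsupp.finsetSum_apply] at hy
  obtain ⟨i, hi, h⟩ := Finset.exists_ne_zero_of_sum_ne_zero hy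
  rw [Finsupp.single_apply] at h
  split_ifs at h with h'
  · exact ⟨i, hi, h, h'⟩
  · exact absurd rfl h

theorem IsConvex.sum_mem {A : Set M} (hA : IsConvex S A) {ι : Type*} {s : Finset ι} {c : ι → S}
    {x : ι → M} (hc : ∑ i ∈ s, c i = 1) (hx : ∀ i ∈ s, c i ≠ 0 → x i ∈ A) :
    ∑ i ∈ s, c i • x i ∈ A := by
  rw [hA]
  refine ⟨∑ i ∈ s, Finsupp.single (x i) (c i), ?_, ?_, ?_⟩
  · intro y hy
    obtain ⟨i, hi, h, rfl⟩ := support_sum_single (Finset.mem_coe.1 hy)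
    exact hx i hi h
  · rw [weight_eq]; simpa using hc
  · rw [combine_eq]; simp

theorem carrier_injective :
    Function.Injective (ConvSubset.carrier : ConvSubset S M → Set M) := fun _ _ h =>
  ConvSubset.ext h

theorem mem_alpha (Φ : ConvSubset S M →₀ S) (m : M) :
    m ∈ alpha S Φ ↔ ∃ u : ConvSubset S M → M, (∀ A ∈ Φ.support, u A ∈ A.carrier) ∧
      Finsupp.linearCombination S u Φ = m := by
  classical
  constructor
  · rintro ⟨_, ⟨u, hu, rfl⟩, rfl⟩
    refine ⟨fun A => u A.carrier, fun A hA => hu _ ?_, ?_⟩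
    · rw [Finsupp.mapDomain_support_of_injective carrier_injective]
      exact Finset.mem_image_of_mem _ hA
    · rw [combine_eq, Finsupp.linearCombination_mapDomain, Finsupp.linearCombination_mapDomain]
      rfl
  · rintro ⟨u, hu, rfl⟩
    let U : Set M → M := fun B => if h : IsConvex S B then u ⟨B, h⟩ else 0
    have hU : ∀ A : ConvSubset S M, U A.carrier = u A := fun A => dif_pos A.isConvex
    refine ⟨_, ⟨U, ?_, rfl⟩, ?_⟩
    · intro A hA
      rw [Finsupp.mapDomain_support_of_injective carrier_injective] at hA
      obtain ⟨B, hB, rfl⟩ := Finset.mem_image.1 hA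
      rw [hU]; exact hu B hB
    · rw [combine_eq, Finsupp.linearCombination_mapDomain, Finsupp.linearCombination_mapDomain]
      congr 2
      funext A
      exact hU A

theorem eq_sum_single {X : Type v} (φ : X →₀ S) :
    φ = ∑ x ∈ φ.support, Finsupp.single x (φ x) := φ.sum_single.symm

theorem linearCombination_mem_alpha {Φ : ConvSubset S M →₀ S} {x : ConvSubset S M → M}
    (hx : ∀ i ∈ Φ.support, x i ∈ i.carrier) : Finsupp.linearCombination S x Φ ∈ alpha S Φ :=
  (mem_alpha _ _).2 ⟨x, hx, rfl⟩

theorem isConvex_image {X Y : Type u} (f : X → Y) {A : Set (X →₀ S)} (hA : IsConvex S A) :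
    IsConvex S (Finsupp.mapDomain f '' A) := by
  classical
  apply isConvex_of_subset
  rintro _ ⟨φ, hφ, h1, rfl⟩
  have : ∀ m, ∃ n, m ∈ φ.support → n ∈ A ∧ Finsupp.mapDomain f n = m := by
    intro m
    by_cases h : m ∈ φ.support
    · obtain ⟨n, hn, e⟩ := hφ h
      exact ⟨n, fun _ => ⟨hn, e⟩⟩
    · exact ⟨0, fun h' => absurd h' h⟩
  choose g hg using this
  refine ⟨∑ m ∈ φ.support, φ m • g m, hA.sum_mem h1 fun m hm _ => (hg m hm).1, ?_⟩
  change Finsupp.lmapDomain S S f _ = _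
  rw [map_sum, combine, Finsupp.sum]
  refine Finset.sum_congr rfl fun m hm => ?_
  rw [map_smul]
  congr 1
  exact (hg m hm).2

theorem isConvex_singleton (m : M) : IsConvex S ({m} : Set M) := by
  apply isConvex_of_subset
  rintro _ ⟨φ, hφ, h1, rfl⟩
  rw [Set.mem_singleton_iff, combine, Finsupp.sum]
  have : ∀ x ∈ φ.support, φ x • x = φ x • m := fun x hx => by
    rw [Set.mem_singleton_iff.1 (hφ hx)]
  have h2 : ∑ x ∈ φ.support, φ x = 1 := h1
  rw [Finset.sum_congr rfl this, ← Finset.sum_smul, h2, one_smul]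

variable [PositiveSemifield S]

theorem eq_zero_of_sum_eq_zero {ι : Type*} {s : Finset ι} {c : ι → S} (h : ∑ i ∈ s, c i = 0) :
    ∀ i ∈ s, c i = 0 := by
  classical
  induction s using Finset.induction_on with
  | empty => simp
  | insert j s hj ih =>
    rw [Finset.sum_insert hj] at h
    obtain ⟨h1, h2⟩ := PositiveSemifield.positive _ _ h
    intro i hi
    rcases Finset.mem_insert.1 hi with rfl | hi
    · exact h1
    · exact ih h2 i hi

theorem mul_ne_zero_of_ne {a b : S} (ha : a ≠ 0) (hb : b ≠ 0) : a * b ≠ 0 := by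
  obtain ⟨x, -, hx⟩ := PositiveSemifield.semifield a ha
  intro h
  apply hb
  rw [← one_mul b, ← hx, mul_assoc, h, mul_zero]

theorem sum_single_ne_zero {ι : Type*} {X : Type v} {s : Finset ι} {c : ι → S} {x : ι → X} {i : ι}
    (hi : i ∈ s) (hc : c i ≠ 0) :
    x i ∈ (∑ i ∈ s, Finsupp.single (x i) (c i)).support := by
  classical
  rw [Finsupp.mem_support_iff, Finsupp.finsetSum_apply]
  intro h
  have := eq_zero_of_sum_eq_zero h i hi
  rw [Finsupp.single_eq_same] at this
  exact hc this

theorem mapDomain_mem_support {X Y : Type v} (f : X → Y) (φ : X →₀ S) {x : X}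
    (hx : x ∈ φ.support) : f x ∈ (φ.mapDomain f).support := by
  have : φ.mapDomain f = ∑ x ∈ φ.support, Finsupp.single (f x) (φ x) := rfl
  rw [this]
  exact sum_single_ne_zero (x := f) hx (Finsupp.mem_support_iff.1 hx)

theorem sum_smul_mem_support {ι : Type*} {X : Type v} {s : Finset ι} {c : ι → S} {F : ι → X →₀ S}
    {i : ι} (hi : i ∈ s) (hc : c i ≠ 0) {x : X} (hx : x ∈ (F i).support) :
    x ∈ (∑ i ∈ s, c i • F i).support := by
  rw [Finsupp.mem_support_iff, Finsupp.finsetSum_apply]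
  intro h
  have := eq_zero_of_sum_eq_zero h i hi
  rw [Finsupp.smul_apply, smul_eq_mul] at this
  exact mul_ne_zero_of_ne hc (Finsupp.mem_support_iff.1 hx) this

theorem sum_mem_alpha {ι : Type*} {s : Finset ι} {c : ι → S} {A : ι → ConvSubset S M} {x : ι → M}
    (hx : ∀ i ∈ s, c i ≠ 0 → x i ∈ (A i).carrier) :
    ∑ i ∈ s, c i • x i ∈ alpha S (∑ i ∈ s, Finsupp.single (A i) (c i)) := by
  classical
  rw [mem_alpha]
  set Ω := ∑ i ∈ s, Finsupp.single (A i) (c i) with hΩ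
  have hval : ∀ B, Ω B = ∑ i ∈ s with A i = B, c i := by
    intro B
    rw [hΩ, Finsupp.finsetSum_apply, Finset.sum_filter]
    exact Finset.sum_congr rfl fun i _ => Finsupp.single_apply
  have hinv : ∀ B, ∃ t : S, B ∈ Ω.support → Ω B * t = 1 ∧ t * Ω B = 1 := by
    intro B
    by_cases h : Ω B = 0
    · exact ⟨0, fun h' => absurd h (Finsupp.mem_support_iff.1 h')⟩
    · obtain ⟨t, ht⟩ := PositiveSemifield.semifield _ h
      exact ⟨t, fun _ => ht⟩
  choose t ht using hinv
  refine ⟨fun B => ∑ i ∈ s with A i = B, (t B * c i) • x i, fun B hB => ?_, ?_⟩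
  · refine B.isConvex.sum_mem ?_ ?_
    · rw [← Finset.mul_sum, ← hval, (ht B hB).2]
    · intro i hi h
      obtain ⟨his, rfl⟩ := Finset.mem_filter.1 hi
      exact hx i his fun h0 => h (by rw [h0, mul_zero])
  · rw [Finsupp.linearCombination_apply, Finsupp.sum]
    have h1 : ∀ B ∈ Ω.support, Ω B • ∑ i ∈ s with A i = B, (t B * c i) • x i =
        ∑ i ∈ s with A i = B, c i • x i := by
      intro B hB
      rw [Finset.smul_sum]
      refine Finset.sum_congr rfl fun i _ => ?_
      rw [smul_smul, ← mul_assoc, (ht B hB).1, one_mul]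
    rw [Finset.sum_congr rfl h1]
    have h2 : ∑ i ∈ s, c i • x i = ∑ i ∈ s with A i ∈ Ω.support, c i • x i := by
      rw [Finset.sum_filter]
      refine Finset.sum_congr rfl fun i hi => ?_
      split_ifs with h
      · rfl
      · by_cases hc : c i = 0
        · rw [hc, zero_smul]
        · exact absurd (sum_single_ne_zero (x := A) hi hc) h
    rw [h2, ← Finset.sum_fiberwise_of_maps_to (s := s.filter fun i => A i ∈ Ω.support)
      (t := Ω.support) (g := A) fun i hi => (Finset.mem_filter.1 hi).2]
    refine Finset.sum_congr rfl fun B hB => Finset.sum_congr ?_ fun _ _ => rfl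
    ext i
    simp only [Finset.mem_filter]
    constructor
    · rintro ⟨h, rfl⟩; exact ⟨⟨h, hB⟩, rfl⟩
    · rintro ⟨⟨h, _⟩, h'⟩; exact ⟨h, h'⟩

/-- The choice of several elements may be made along any presentation of `Φ` as a finite sum of
multiples of elements of the support. -/
theorem sum_mem_alpha_mapDomain {ι : Type v} {Φ : ι →₀ S} {A : ι → ConvSubset S M} {x : ι → M}
    (hx : ∀ i ∈ Φ.support, x i ∈ (A i).carrier) :
    Finsupp.linearCombination S x Φ ∈ alpha S (Φ.mapDomain A) :=
  sum_mem_alpha (c := Φ) fun i hi _ => hx i hi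

theorem isConvex_iUnion_alpha {𝒜 : Set (ConvSubset S M →₀ S)} (h𝒜 : IsConvex S 𝒜) :
    IsConvex S (⋃ Ω ∈ 𝒜, alpha S Ω) := by
  classical
  apply isConvex_of_subset
  rintro _ ⟨φ, hφ, h1, rfl⟩
  have : ∀ m, ∃ (Ω : ConvSubset S M →₀ S) (u : ConvSubset S M → M), m ∈ φ.support →
      Ω ∈ 𝒜 ∧ (∀ A ∈ Ω.support, u A ∈ A.carrier) ∧ Finsupp.linearCombination S u Ω = m := by
    intro m
    by_cases h : m ∈ φ.support
    · have hm := hφ h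
      simp only [Set.mem_iUnion] at hm
      obtain ⟨Ω, hΩ, hm⟩ := hm
      obtain ⟨u, hu⟩ := (mem_alpha _ _).1 hm
      exact ⟨Ω, u, fun _ => ⟨hΩ, hu⟩⟩
    · exact ⟨0, 0, fun h' => absurd h' h⟩
  choose Ω u h using this
  simp only [Set.mem_iUnion]
  refine ⟨∑ m ∈ φ.support, φ m • Ω m, h𝒜.sum_mem h1 fun m hm _ => (h m hm).1, ?_⟩
  have e1 : ∑ m ∈ φ.support, φ m • Ω m = ∑ p ∈ φ.support.sigma fun m => (Ω m).support,
      Finsupp.single p.2 (φ p.1 * Ω p.1 p.2) := by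
    rw [Finset.sum_sigma]
    refine Finset.sum_congr rfl fun m _ => ?_
    conv_lhs => rw [eq_sum_single (Ω m), Finset.smul_sum]
    simp
  have e2 : combine S φ = ∑ p ∈ φ.support.sigma fun m => (Ω m).support,
      (φ p.1 * Ω p.1 p.2) • u p.1 p.2 := by
    rw [Finset.sum_sigma, combine, Finsupp.sum]
    refine Finset.sum_congr rfl fun m hm => ?_
    have h3 : φ m • m = φ m • Finsupp.linearCombination S (u m) (Ω m) := by rw [(h m hm).2.2]
    rw [h3, Finsupp.linearCombination_apply, Finsupp.sum, Finset.smul_sum]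
    exact Finset.sum_congr rfl fun A _ => smul_smul _ _ _
  rw [e1, e2]
  refine sum_mem_alpha fun p hp _ => ?_
  rw [Finset.mem_sigma] at hp
  exact (h p.1 hp.1).2.1 p.2 hp.2

end Aux

/-! ### The monad of convex sets of finitely supported functions -/

section Data

variable (S : Type u) [Semiring S]

/-- Convex subsets of the free left `S`-semimodule `X →₀ S`. -/
abbrev ConvPow (X : Type u) : Type u := ConvSubset S (X →₀ S)

variable {S}

/-- Direct image of a convex set along the pushforward `X →₀ S → Y →₀ S` of `f : X → Y`. -/
def mapConv {X Y : Type u} (f : X → Y) (A : ConvPow S X) : ConvPow S Y where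
  carrier := Finsupp.mapDomain f '' A.carrier
  isConvex := isConvex_image f A.isConvex

/-- The unit `x ↦ {Δ_x}`. -/
noncomputable def unitConv {X : Type u} (x : X) : ConvPow S X where
  carrier := {Finsupp.single x 1}
  isConvex := isConvex_singleton _

/-- The multiplication `𝒜 ↦ ⋃ Ω ∈ 𝒜, α(Ω)`. -/
def multConv [PositiveSemifield S] {X : Type u} (𝒜 : ConvPow S (ConvPow S X)) : ConvPow S X where
  carrier := ⋃ Ω ∈ 𝒜.carrier, alpha S Ω
  isConvex := isConvex_iUnion_alpha 𝒜.isConvex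

end Data

section Laws

variable {S : Type u} [Semiring S]

theorem mapConv_id {X : Type u} (A : ConvPow S X) : mapConv id A = A := by
  apply ConvSubset.ext
  simp [mapConv]

theorem mapConv_comp {X Y Z : Type u} (f : X → Y) (g : Y → Z) (A : ConvPow S X) :
    mapConv (g ∘ f) A = mapConv g (mapConv f A) := by
  apply ConvSubset.ext
  simp only [mapConv, Set.image_image]
  exact Set.image_congr fun φ _ => Finsupp.mapDomain_comp

theorem mapConv_unit {X Y : Type u} (f : X → Y) (x : X) :
    mapConv f (unitConv x : ConvPow S X) = unitConv (f x) := by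
  apply ConvSubset.ext
  simp [mapConv, unitConv]

theorem mapDomain_linearCombination {X Y Z : Type u} (f : X → Y) (u : Z → X →₀ S) (Ω : Z →₀ S) :
    Finsupp.mapDomain f (Finsupp.linearCombination S u Ω) =
      Finsupp.linearCombination S (fun z => Finsupp.mapDomain f (u z)) Ω := by
  change Finsupp.lmapDomain S S f _ = _
  rw [Finsupp.linearCombination_apply, Finsupp.linearCombination_apply, Finsupp.sum, map_sum]
  exact Finset.sum_congr rfl fun _ _ => map_smul _ _ _

theorem linearCombination_congr {X : Type u} {Z : Type u} {u w : Z → X →₀ S} {Ω : Z →₀ S}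
    (h : ∀ z ∈ Ω.support, u z = w z) :
    Finsupp.linearCombination S u Ω = Finsupp.linearCombination S w Ω := by
  rw [Finsupp.linearCombination_apply, Finsupp.linearCombination_apply]
  exact Finset.sum_congr rfl fun z hz => congrArg (Ω z • ·) (h z hz)

variable [PositiveSemifield S]

theorem mem_multConv {X : Type u} {𝒜 : ConvPow S (ConvPow S X)} {m : X →₀ S} :
    m ∈ (multConv 𝒜).carrier ↔ ∃ Ω ∈ 𝒜.carrier, m ∈ alpha S Ω := by
  simp [multConv]

theorem mapConv_mult {X Y : Type u} (f : X → Y) (𝒜 : ConvPow S (ConvPow S X)) :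
    mapConv f (multConv 𝒜) = multConv (mapConv (mapConv f) 𝒜) := by
  apply ConvSubset.ext
  ext m
  rw [mem_multConv]
  constructor
  · rintro ⟨n, hn, rfl⟩
    obtain ⟨Ω, hΩ, hn⟩ := mem_multConv.1 hn
    obtain ⟨u, hu, rfl⟩ := (mem_alpha _ _).1 hn
    refine ⟨_, ⟨Ω, hΩ, rfl⟩, ?_⟩
    rw [mapDomain_linearCombination]
    exact sum_mem_alpha_mapDomain fun A hA => ⟨u A, hu A hA, rfl⟩
  · rintro ⟨_, ⟨Ω, hΩ, rfl⟩, hm⟩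
    obtain ⟨v, hv, rfl⟩ := (mem_alpha _ _).1 hm
    have : ∀ A : ConvPow S X, ∃ n, A ∈ Ω.support → n ∈ A.carrier ∧
        Finsupp.mapDomain f n = v (mapConv f A) := by
      intro A
      by_cases h : A ∈ Ω.support
      · obtain ⟨n, hn, e⟩ := hv _ (mapDomain_mem_support (mapConv f) Ω h)
        exact ⟨n, fun _ => ⟨hn, e⟩⟩
      · exact ⟨0, fun h' => absurd h' h⟩
    choose u hu using this
    refine ⟨Finsupp.linearCombination S u Ω, mem_multConv.2 ⟨Ω, hΩ,
      linearCombination_mem_alpha fun A hA => (hu A hA).1⟩, ?_⟩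
    rw [mapDomain_linearCombination, Finsupp.linearCombination_mapDomain]
    exact linearCombination_congr fun A hA => (hu A hA).2

theorem mult_unit {X : Type u} (A : ConvPow S X) : multConv (unitConv A) = A := by
  rcases subsingleton_or_nontrivial S with hS | hS
  · apply ConvSubset.ext
    have h0 : ∀ (M : Type u) [AddCommMonoid M] [Module S M] [Subsingleton M] (B : ConvSubset S M),
        B.carrier = Set.univ := by
      intro M _ _ _ B
      ext m
      simp only [Set.mem_univ, iff_true]
      rw [B.isConvex]
      exact ⟨0, by simp, Subsingleton.elim _ _, Subsingleton.elim _ _⟩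
    rw [h0 _ A, h0]
  apply ConvSubset.ext
  ext m
  rw [mem_multConv]
  constructor
  · rintro ⟨_, rfl, hm⟩
    obtain ⟨u, hu, rfl⟩ := (mem_alpha _ _).1 hm
    rw [Finsupp.linearCombination_single, one_smul]
    exact hu A (by simp)
  · intro hm
    refine ⟨_, rfl, (mem_alpha _ _).2 ⟨fun _ => m, fun B hB => ?_, by simp⟩⟩
    have := Finsupp.support_single_subset hB
    rw [Finset.mem_singleton] at this
    exact this ▸ hm

theorem mult_map_unit {X : Type u} (A : ConvPow S X) :
    multConv (mapConv (unitConv : X → ConvPow S X) A) = A := by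
  have key : ∀ φ : X →₀ S, Finsupp.linearCombination S (fun x => Finsupp.single x (1 : S)) φ = φ := by
    intro φ
    rw [Finsupp.linearCombination_apply]
    simp
  apply ConvSubset.ext
  ext m
  rw [mem_multConv]
  constructor
  · rintro ⟨_, ⟨φ, hφ, rfl⟩, hm⟩
    obtain ⟨u, hu, rfl⟩ := (mem_alpha _ _).1 hm
    rw [Finsupp.linearCombination_mapDomain, linearCombination_congr
      (w := fun x => Finsupp.single x (1 : S)), key]
    · exact hφ
    · intro x hx
      exact hu _ (mapDomain_mem_support _ φ hx)
  · intro hm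
    refine ⟨_, ⟨m, hm, rfl⟩, ?_⟩
    have h := sum_mem_alpha_mapDomain (Φ := m) (x := fun x => Finsupp.single x (1 : S))
      (A := unitConv) fun x _ => Set.mem_singleton _
    rwa [key] at h

theorem mult_assoc {X : Type u} (𝔸 : ConvPow S (ConvPow S (ConvPow S X))) :
    multConv (mapConv multConv 𝔸) = multConv (multConv 𝔸) := by
  classical
  apply ConvSubset.ext
  ext m
  rw [mem_multConv, mem_multConv]
  constructor
  · rintro ⟨_, ⟨Ξ, hΞ, rfl⟩, hm⟩
    obtain ⟨u, hu, rfl⟩ := (mem_alpha _ _).1 hm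
    have : ∀ 𝒜 : ConvPow S (ConvPow S X), ∃ (Ω : ConvPow S X →₀ S) (w : ConvPow S X → X →₀ S),
        𝒜 ∈ Ξ.support → Ω ∈ 𝒜.carrier ∧ (∀ A ∈ Ω.support, w A ∈ A.carrier) ∧
          Finsupp.linearCombination S w Ω = u (multConv 𝒜) := by
      intro 𝒜
      by_cases h : 𝒜 ∈ Ξ.support
      · obtain ⟨Ω, hΩ, h'⟩ := mem_multConv.1 (hu _ (mapDomain_mem_support _ Ξ h))
        obtain ⟨w, hw⟩ := (mem_alpha _ _).1 h'
        exact ⟨Ω, w, fun _ => ⟨hΩ, hw⟩⟩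
      · exact ⟨0, 0, fun h' => absurd h' h⟩
    choose Ω w h using this
    refine ⟨Finsupp.linearCombination S Ω Ξ, mem_multConv.2 ⟨Ξ, hΞ,
      linearCombination_mem_alpha fun 𝒜 h𝒜 => (h 𝒜 h𝒜).1⟩, ?_⟩
    have e1 : Finsupp.linearCombination S Ω Ξ = ∑ p ∈ Ξ.support.sigma fun 𝒜 => (Ω 𝒜).support,
        Finsupp.single p.2 (Ξ p.1 * Ω p.1 p.2) := by
      rw [Finset.sum_sigma, Finsupp.linearCombination_apply, Finsupp.sum]
      refine Finset.sum_congr rfl fun 𝒜 _ => ?_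
      conv_lhs => rw [eq_sum_single (Ω 𝒜), Finset.smul_sum]
      simp
    have e2 : Finsupp.linearCombination S u (Finsupp.mapDomain multConv Ξ) =
        ∑ p ∈ Ξ.support.sigma fun 𝒜 => (Ω 𝒜).support, (Ξ p.1 * Ω p.1 p.2) • w p.1 p.2 := by
      rw [Finset.sum_sigma, Finsupp.linearCombination_mapDomain, Finsupp.linearCombination_apply,
        Finsupp.sum]
      refine Finset.sum_congr rfl fun 𝒜 h𝒜 => ?_
      rw [Function.comp_apply, ← (h 𝒜 h𝒜).2.2, Finsupp.linearCombination_apply, Finsupp.sum,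
        Finset.smul_sum]
      exact Finset.sum_congr rfl fun A _ => smul_smul _ _ _
    rw [e1, e2]
    refine sum_mem_alpha fun p hp _ => ?_
    rw [Finset.mem_sigma] at hp
    exact (h p.1 hp.1).2.1 p.2 hp.2
  · rintro ⟨Ω, hΩ, hm⟩
    obtain ⟨Ξ, hΞ, hΩ⟩ := mem_multConv.1 hΩ
    obtain ⟨F, hF, rfl⟩ := (mem_alpha _ _).1 hΩ
    obtain ⟨u, hu, rfl⟩ := (mem_alpha _ _).1 hm
    refine ⟨_, ⟨Ξ, hΞ, rfl⟩, ?_⟩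
    have e : Finsupp.linearCombination S u (Finsupp.linearCombination S F Ξ) =
        Finsupp.linearCombination S (fun 𝒜 => Finsupp.linearCombination S u (F 𝒜)) Ξ := by
      rw [Finsupp.linearCombination_apply S Ξ, Finsupp.linearCombination_apply S Ξ, Finsupp.sum,
        map_sum]
      exact Finset.sum_congr rfl fun _ _ => map_smul _ _ _
    rw [e]
    refine sum_mem_alpha_mapDomain fun 𝒜 h𝒜 => mem_multConv.2 ⟨F 𝒜, hF 𝒜 h𝒜,
      linearCombination_mem_alpha fun A hA => hu A ?_⟩
    rw [Finsupp.linearCombination_apply]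
    exact sum_smul_mem_support h𝒜 (Finsupp.mem_support_iff.1 h𝒜) hA

end Laws

/-- The monad `P_c S` on the category of sets: it sends `X` to the set of convex subsets of the
free left `S`-semimodule on `X`. -/
noncomputable def convMonad (S : Type u) [Semiring S] [PositiveSemifield S] : CategoryTheory.Monad (Type u) where
  obj X := ConvPow S X
  map f := ↾(mapConv f)
  map_id X := by apply ConcreteCategory.hom_ext; intro A; exact mapConv_id A
  map_comp f g := by apply ConcreteCategory.hom_ext; intro A; exact mapConv_comp f g A
  η :=
    { app := fun X => ↾(unitConv : X → ConvPow S X)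
      naturality := fun X Y f => by apply ConcreteCategory.hom_ext; intro x; exact (mapConv_unit f x).symm }
  μ :=
    { app := fun X => ↾(multConv : ConvPow S (ConvPow S X) → ConvPow S X)
      naturality := fun X Y f => by apply ConcreteCategory.hom_ext; intro 𝒜; exact (mapConv_mult f 𝒜).symm }
  assoc X := by apply ConcreteCategory.hom_ext; intro 𝔸; exact mult_assoc 𝔸
  left_unit X := by apply ConcreteCategory.hom_ext; intro A; exact mult_unit A
  right_unit X := by apply ConcreteCategory.hom_ext; intro A; exact mult_map_unit A

/-! ### Infinitary algebraic theories -/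

/-- A signature: a class of operations, each with a (possibly infinite) set as its arity. -/
structure Signature where
  Op : Type (u + 1)
  Arity : Op → Type u

/-- Terms over a signature with variables in `V`. -/
inductive Term (Sg : Signature.{u}) (V : Type u) : Type (u + 1)
  | var : V → Term Sg V
  | op (o : Sg.Op) : (Sg.Arity o → Term Sg V) → Term Sg V

/-- An equation between two terms over a set of variables. -/
structure Equation (Sg : Signature.{u}) where
  Vars : Type u
  lhs : Term Sg Vars
  rhs : Term Sg Vars

/-- An algebraic theory: a signature together with a class of equations. -/
structure AlgebraicTheory where
  sig : Signature.{u}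
  eqns : Set (Equation sig)

/-- The value of a term under a valuation of its variables in a set that carries operations. -/
def Term.eval {Sg : Signature.{u}} {V A : Type u} (ops : ∀ o : Sg.Op, (Sg.Arity o → A) → A)
    (val : V → A) : Term Sg V → A
  | .var x => val x
  | .op o ts => ops o fun i => (ts i).eval ops val

/-- An algebra for an algebraic theory. -/
structure AlgebraicTheory.Alg (T : AlgebraicTheory.{u}) where
  carrier : Type u
  ops : ∀ o : T.sig.Op, (T.sig.Arity o → carrier) → carrier
  sat : ∀ e ∈ T.eqns, ∀ val : e.Vars → carrier, e.lhs.eval ops val = e.rhs.eval ops val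

/-- A homomorphism of algebras: a function that respects all operations. -/
@[ext]
structure AlgebraicTheory.Alg.Hom {T : AlgebraicTheory.{u}} (A B : T.Alg) where
  toFun : A.carrier → B.carrier
  map_ops : ∀ (o : T.sig.Op) (x : T.sig.Arity o → A.carrier),
    toFun (A.ops o x) = B.ops o fun i => toFun (x i)

/-- The category of algebras for an algebraic theory. -/
instance AlgebraicTheory.algCategory (T : AlgebraicTheory.{u}) : Category T.Alg where
  Hom A B := AlgebraicTheory.Alg.Hom A B
  id A := { toFun := fun x => x, map_ops := fun _ _ => rfl }
  comp f g :=
    { toFun := fun x => g.toFun (f.toFun x)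
      map_ops := fun o x => by rw [f.map_ops, g.map_ops] }

/-- The forgetful functor from algebras to sets. -/
def AlgebraicTheory.forget (T : AlgebraicTheory.{u}) : T.Alg ⥤ Type u where
  obj A := A.carrier
  map f := ↾(AlgebraicTheory.Alg.Hom.toFun f)

/-- A theory presents a monad if the categories of Eilenberg-Moore algebras and of algebras for
the theory are isomorphic, by functors that leave the underlying sets and functions unchanged. -/
def AlgebraicTheory.Presents (T : AlgebraicTheory.{u}) (M : CategoryTheory.Monad (Type u)) : Prop :=
  ∃ (F : M.Algebra ⥤ T.Alg) (G : T.Alg ⥤ M.Algebra),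
    F ⋙ G = 𝟭 M.Algebra ∧ G ⋙ F = 𝟭 T.Alg ∧ F ⋙ T.forget = M.forget

/-! ### The theory of complete semilattices, semimodules and distributivity -/

section Theory

variable (S : Type u)

/-- The operations: a join of arity `I` for every set `I`, a binary sum, a zero, and a unary scalar
multiplication for every element of `S`. -/
inductive ConvOp : Type (u + 1)
  | join (I : Type u) : ConvOp
  | add : ConvOp
  | zero : ConvOp
  | smul (a : S) : ConvOp

/-- The signature with the operations above. -/
def convSig : Signature.{u} where
  Op := ConvOp S
  Arity
    | .join I => I
    | .add => ULift.{u} Bool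
    | .zero => PEmpty.{u + 1}
    | .smul _ => PUnit.{u + 1}

variable {S} {V : Type u}

/-- The term `⋁ i : I, t i`. -/
def tJoin (I : Type u) (t : I → Term (convSig S) V) : Term (convSig S) V :=
  Term.op (Sg := convSig S) (ConvOp.join I) t

/-- The term `s + t`. -/
def tAdd (s t : Term (convSig S) V) : Term (convSig S) V :=
  Term.op (Sg := convSig S) ConvOp.add fun b : ULift.{u} Bool => bif b.down then t else s

/-- The term `0`. -/
def tZero : Term (convSig S) V :=
  Term.op (Sg := convSig S) ConvOp.zero fun e : PEmpty.{u + 1} => e.elim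

/-- The term `a · t`. -/
def tSmul (a : S) (t : Term (convSig S) V) : Term (convSig S) V :=
  Term.op (Sg := convSig S) (ConvOp.smul a) fun _ : PUnit.{u + 1} => t

/-- The term that consists of a variable. -/
def tVar (x : V) : Term (convSig S) V := Term.var x

variable (S)

/-- The axioms of complete semilattices. -/
inductive SemilatticeAxiom : Equation (convSig S) → Prop
  | singleton : SemilatticeAxiom
      ⟨PUnit.{u + 1}, tJoin PUnit.{u + 1} fun i => tVar i, tVar PUnit.unit⟩
  | reindex {I J : Type u} (f : I → J) (hf : Function.Surjective f) : SemilatticeAxiom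
      ⟨J, tJoin J fun j => tVar j, tJoin I fun i => tVar (f i)⟩
  | assoc {I J : Type u} (f : I → J) : SemilatticeAxiom
      ⟨I, tJoin I fun i => tVar i, tJoin J fun j => tJoin {i : I // f i = j} fun i => tVar i.1⟩

/-- The axioms of left `S`-semimodules, with variables `x = 0`, `y = 1`, `z = 2`. -/
inductive SemimoduleAxiom [Semiring S] : Equation (convSig S) → Prop
  | add_assoc : SemimoduleAxiom ⟨ULift.{u} (Fin 3),
      tAdd (tAdd (tVar ⟨0⟩) (tVar ⟨1⟩)) (tVar ⟨2⟩), tAdd (tVar ⟨0⟩) (tAdd (tVar ⟨1⟩) (tVar ⟨2⟩))⟩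
  | add_comm : SemimoduleAxiom ⟨ULift.{u} (Fin 3),
      tAdd (tVar ⟨0⟩) (tVar ⟨1⟩), tAdd (tVar ⟨1⟩) (tVar ⟨0⟩)⟩
  | add_zero : SemimoduleAxiom ⟨ULift.{u} (Fin 3), tAdd (tVar ⟨0⟩) tZero, tVar ⟨0⟩⟩
  | smul_zero (a : S) : SemimoduleAxiom ⟨ULift.{u} (Fin 3), tSmul a tZero, tZero⟩
  | zero_smul : SemimoduleAxiom ⟨ULift.{u} (Fin 3), tSmul 0 (tVar ⟨0⟩), tZero⟩
  | one_smul : SemimoduleAxiom ⟨ULift.{u} (Fin 3), tSmul 1 (tVar ⟨0⟩), tVar ⟨0⟩⟩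
  | mul_smul (a b : S) : SemimoduleAxiom ⟨ULift.{u} (Fin 3),
      tSmul (a * b) (tVar ⟨0⟩), tSmul a (tSmul b (tVar ⟨0⟩))⟩
  | smul_add (a : S) : SemimoduleAxiom ⟨ULift.{u} (Fin 3),
      tSmul a (tAdd (tVar ⟨0⟩) (tVar ⟨1⟩)), tAdd (tSmul a (tVar ⟨0⟩)) (tSmul a (tVar ⟨1⟩))⟩
  | add_smul (a b : S) : SemimoduleAxiom ⟨ULift.{u} (Fin 3),
      tSmul (a + b) (tVar ⟨0⟩), tAdd (tSmul a (tVar ⟨0⟩)) (tSmul b (tVar ⟨0⟩))⟩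

/-- The distributivity axioms. -/
inductive DistribAxiom [Semiring S] : Equation (convSig S) → Prop
  | smul_join (a : S) (ha : a ≠ 0) (I : Type u) : DistribAxiom
      ⟨I, tSmul a (tJoin I fun i => tVar i), tJoin I fun i => tSmul a (tVar i)⟩
  | add_join (I J : Type u) : DistribAxiom
      ⟨I ⊕ J, tAdd (tJoin I fun i => tVar (Sum.inl i)) (tJoin J fun j => tVar (Sum.inr j)),
        tJoin (I × J) fun p => tAdd (tVar (Sum.inl p.1)) (tVar (Sum.inr p.2))⟩

/-- The theory whose algebras are complete semilattices and left `S`-semimodules that satisfy the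
distributivity axioms. -/
def convTheory [Semiring S] : AlgebraicTheory.{u} where
  sig := convSig S
  eqns := {e | SemilatticeAxiom S e} ∪ {e | SemimoduleAxiom S e} ∪ {e | DistribAxiom S e}

end Theory

end ConvexPowerset

namespace ConvexPowerset

/-! ### Convex sets -/

section ConvexSets

variable {S : Type u} [Semiring S] {M : Type v} [AddCommMonoid M] [Module S M]

/-! The proof shows that the set of convex subsets of a semimodule is itself a model of the theory,
and that the monad multiplication is the canonical evaluation in that model.

Convex sets are added by Minkowski sum and ordered by inclusion. A nonzero scalar acts by direct
image, while the scalar `0` sends every set to `{0}`. The join of a family is the convex hull of its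
union. Convexity is what makes `(a + b) • A = a • A + b • A` hold, and the distributive laws follow
because translations and nonzero scalings have right adjoints (`DistribSup`). In this semimodule a
linear combination of convex sets is exactly `alpha` (`ConvSubset.carrier_combine`).

Every model `A` carries the evaluation `extend`, which takes a convex set of formal combinations to
the join of their values. Since down-sets `Set.Iic t` are convex, `extend` is a homomorphism
(`isSupLinear_extend`). Every homomorphism commutes with evaluation (`IsSupLinear.map_extend`), and
on convex sets evaluation is `multConv` (`extend_eq_multConv`). Together these give the
Eilenberg–Moore associativity law for `extend`.

Conversely, an Eilenberg–Moore structure map transports the operations of `ConvPow S E.A` to `E.A`.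
It becomes a homomorphism by associativity and naturality (`structureMap_moduleOps`), so the
equations descend. The two constructions are mutually inverse because the structure map is a
homomorphism split by the unit (`extend_algOfAlgebra`). -/

theorem isConvex_of_sum_mem {A : Set M}
    (h : ∀ φ : M →₀ S, (∀ x ∈ φ.support, x ∈ A) → ∑ x ∈ φ.support, φ x = 1 →
      ∑ x ∈ φ.support, φ x • x ∈ A) : IsConvex S A := by
  apply isConvex_of_subset
  rintro _ ⟨φ, hφ, h1, rfl⟩
  exact h φ (fun x hx => hφ hx) h1

theorem IsConvex.add_mem {A : Set M} (hA : IsConvex S A) {a b : S} (hab : a + b = 1) {x y : M}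
    (hx : x ∈ A) (hy : y ∈ A) : a • x + b • y ∈ A := by
  have h := hA.sum_mem (s := Finset.univ) (c := fun i : Bool => bif i then a else b)
    (x := fun i : Bool => bif i then x else y) (by simpa using hab) (by simp [hx, hy])
  simpa using h

theorem IsConvex.preimage {N : Type*} [AddCommMonoid N] [Module S N] (f : M →ₗ[S] N) {A : Set N}
    (hA : IsConvex S A) : IsConvex S (f ⁻¹' A) := by
  refine isConvex_of_sum_mem fun φ hφ h1 => ?_
  rw [Set.mem_preimage, map_sum]
  simp only [map_smul]
  exact hA.sum_mem h1 fun x hx _ => hφ x hx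

theorem convClosure_subset {A B : Set M} (hB : IsConvex S B) (h : A ⊆ B) :
    convClosure S A ⊆ B := by
  rintro _ ⟨φ, hφ, h1, rfl⟩
  exact hB.sum_mem h1 fun x hx _ => h (hφ hx)

/-- Nested combinations flatten: weights that sum to one, applied to formal combinations of weight
one, give a formal combination of weight one. -/
theorem isConvex_convClosure (A : Set M) : IsConvex S (convClosure S A) := by
  refine isConvex_of_sum_mem fun φ hφ h1 => ?_
  have : ∀ m, ∃ ψ : M →₀ S, m ∈ φ.support → (ψ.support : Set M) ⊆ A ∧
      (ψ.sum fun _ s => s) = 1 ∧ combine S ψ = m := by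
    intro m
    by_cases h : m ∈ φ.support
    · obtain ⟨ψ, hψ⟩ := hφ m h
      exact ⟨ψ, fun _ => hψ⟩
    · exact ⟨0, fun h' => absurd h' h⟩
  choose ψ hψ using this
  refine ⟨∑ m ∈ φ.support, φ m • ψ m, fun x hx => ?_, ?_, ?_⟩
  · rw [Finset.mem_coe, Finsupp.mem_support_iff, Finsupp.finsetSum_apply] at hx
    obtain ⟨m, hm, h⟩ := Finset.exists_ne_zero_of_sum_ne_zero hx
    refine (hψ m hm).1 (Finset.mem_coe.2 (Finsupp.mem_support_iff.2 fun h0 => h ?_))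
    rw [Finsupp.smul_apply, h0, smul_zero]
  · rw [weight_eq, map_sum]
    refine Eq.trans ?_ h1
    refine Finset.sum_congr rfl fun m hm => ?_
    rw [map_smul, ← weight_eq, (hψ m hm).2.1, smul_eq_mul, mul_one]
  · rw [combine_eq, map_sum]
    refine Finset.sum_congr rfl fun m hm => ?_
    rw [map_smul, ← combine_eq, (hψ m hm).2.2]

instance : PartialOrder (ConvSubset S M) := PartialOrder.lift _ carrier_injective

theorem ConvSubset.le_iff {A B : ConvSubset S M} : A ≤ B ↔ A.carrier ⊆ B.carrier := Iff.rfl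

/-- A union of convex sets need not be convex, so the join is the convex hull of the union. -/
instance : SupSet (ConvSubset S M) where
  sSup 𝒜 := ⟨convClosure S (⋃ A ∈ 𝒜, A.carrier), isConvex_convClosure _⟩

noncomputable instance : CompleteLattice (ConvSubset S M) :=
  completeLatticeOfSup _ fun _ =>
    ⟨fun _ hA => (Set.subset_biUnion_of_mem hA).trans (subset_convClosure _),
      fun B hB => convClosure_subset B.isConvex (Set.iUnion₂_subset fun _ hA => hB hA)⟩

/-- Needed to compare joins with the plain union in the definition of `multConv`. -/
theorem ConvSubset.carrier_iSup_of_isConvex {ι : Sort*} {A : ι → ConvSubset S M}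
    (h : IsConvex S (⋃ i, (A i).carrier)) : (⨆ i, A i).carrier = ⋃ i, (A i).carrier := by
  apply Set.Subset.antisymm
  · exact ConvSubset.le_iff.1 (iSup_le (a := ⟨_, h⟩) fun i =>
      Set.subset_iUnion (fun i => (A i).carrier) i)
  · exact Set.iUnion_subset fun i => ConvSubset.le_iff.1 (le_iSup A i)

end ConvexSets

/-! ### The semimodule of convex subsets. -/

section ConvexModule

variable {S : Type u} [Semiring S] {M : Type v} [AddCommMonoid M] [Module S M]

instance : Zero (ConvSubset S M) where
  zero := ⟨{0}, isConvex_singleton _⟩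

instance : Add (ConvSubset S M) where
  add A B :=
    { carrier := {m | ∃ x ∈ A.carrier, ∃ y ∈ B.carrier, x + y = m}
      isConvex := by
        refine isConvex_of_sum_mem fun φ hφ h1 => ?_
        have : ∀ m, ∃ x y, m ∈ φ.support → x ∈ A.carrier ∧ y ∈ B.carrier ∧ x + y = m := by
          intro m
          by_cases h : m ∈ φ.support
          · obtain ⟨x, hx, y, hy⟩ := hφ m h
            exact ⟨x, y, fun _ => ⟨hx, hy⟩⟩
          · exact ⟨0, 0, fun h' => absurd h' h⟩
        choose x y h using this
        refine ⟨_, A.isConvex.sum_mem h1 fun m hm _ => (h m hm).1,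
          _, B.isConvex.sum_mem h1 fun m hm _ => (h m hm).2.1, ?_⟩
        rw [← Finset.sum_add_distrib]
        refine Finset.sum_congr rfl fun m hm => ?_
        rw [← smul_add, (h m hm).2.2] }

theorem ConvSubset.mem_zero {m : M} : m ∈ (0 : ConvSubset S M).carrier ↔ m = 0 := Iff.rfl

theorem ConvSubset.mem_add {A B : ConvSubset S M} {m : M} :
    m ∈ (A + B).carrier ↔ ∃ x ∈ A.carrier, ∃ y ∈ B.carrier, x + y = m := Iff.rfl

instance : AddCommMonoid (ConvSubset S M) where
  nsmul := nsmulRec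
  add_assoc A B C := by
    ext m
    simp only [ConvSubset.mem_add]
    constructor
    · rintro ⟨_, ⟨x, hx, y, hy, rfl⟩, z, hz, rfl⟩
      exact ⟨x, hx, _, ⟨y, hy, z, hz, rfl⟩, (add_assoc _ _ _).symm⟩
    · rintro ⟨x, hx, _, ⟨y, hy, z, hz, rfl⟩, rfl⟩
      exact ⟨_, ⟨x, hx, y, hy, rfl⟩, z, hz, add_assoc _ _ _⟩
  add_comm A B := by
    ext m
    simp only [ConvSubset.mem_add]
    constructor <;> rintro ⟨x, hx, y, hy, rfl⟩ <;> exact ⟨y, hy, x, hx, add_comm _ _⟩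
  zero_add A := by
    ext m
    simp [ConvSubset.mem_add, ConvSubset.mem_zero]
  add_zero A := by
    ext m
    simp [ConvSubset.mem_add, ConvSubset.mem_zero]

theorem ConvSubset.mem_sum {ι : Type*} {s : Finset ι} {A : ι → ConvSubset S M} {m : M} :
    m ∈ (∑ i ∈ s, A i).carrier ↔ ∃ x : ι → M, (∀ i ∈ s, x i ∈ (A i).carrier) ∧
      ∑ i ∈ s, x i = m := by
  classical
  induction s using Finset.induction_on generalizing m with
  | empty => simp [ConvSubset.mem_zero, eq_comm]
  | insert j s hj ih =>
    rw [Finset.sum_insert hj, ConvSubset.mem_add]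
    constructor
    · rintro ⟨x, hx, y, hy, rfl⟩
      obtain ⟨z, hz, rfl⟩ := ih.1 hy
      refine ⟨Function.update z j x, fun i hi => ?_, ?_⟩
      · by_cases h : i = j
        · subst h; simpa using hx
        · rw [Function.update_of_ne h]; exact hz i (Finset.mem_of_mem_insert_of_ne hi h)
      · rw [Finset.sum_insert hj, Function.update_self]
        congr 1
        exact Finset.sum_congr rfl fun i hi =>
          Function.update_of_ne (by rintro rfl; exact hj hi) _ _
    · rintro ⟨x, hx, rfl⟩
      exact ⟨x j, hx j (Finset.mem_insert_self _ _), _,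
        ih.2 ⟨x, fun i hi => hx i (Finset.mem_insert_of_mem hi), rfl⟩,
        (Finset.sum_insert hj).symm⟩

/-- A positive semifield may be trivial. Then `0 = 1`, so the empty combination has weight one and
even the empty set generates the single point of `M`. This case is treated apart wherever `1 ≠ 0` is
needed. -/
theorem ConvSubset.eq_of_subsingleton [Subsingleton S] (A B : ConvSubset S M) : A = B := by
  have : ∀ C : ConvSubset S M, C.carrier = Set.univ := fun C => by
    have := Module.subsingleton S M
    ext m
    simp only [Set.mem_univ, iff_true]
    rw [C.isConvex]
    exact ⟨0, by simp, Subsingleton.elim _ _, Subsingleton.elim _ _⟩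
  exact ConvSubset.ext ((this A).trans (this B).symm)

variable [PositiveSemifield S]

theorem isConvex_smul (a : S) (ha : a ≠ 0) {A : Set M} (hA : IsConvex S A) :
    IsConvex S ((fun x => a • x) '' A) := by
  obtain ⟨b, hab, hba⟩ := PositiveSemifield.semifield a ha
  -- As `S` need not be commutative, `a` cannot be pulled out of a combination directly. The weights
  -- are conjugated by `a` instead, and still sum to `b * 1 * a = 1`.
  refine isConvex_of_sum_mem fun φ hφ h1 => ⟨∑ x ∈ φ.support, (b * φ x * a) • b • x, ?_, ?_⟩
  · refine hA.sum_mem ?_ fun x hx _ => ?_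
    · rw [← Finset.sum_mul, ← Finset.mul_sum, h1, mul_one, hba]
    · obtain ⟨y, hy, rfl⟩ := hφ x hx
      change b • a • y ∈ A
      rwa [smul_smul, hba, one_smul]
  · change a • _ = _
    rw [Finset.smul_sum]
    refine Finset.sum_congr rfl fun x _ => ?_
    rw [smul_smul, smul_smul, mul_assoc b, ← mul_assoc a, hab, one_mul, mul_assoc, hab, mul_one]

-- The case `a = 0` is separate because the direct image of the empty set is empty, whereas `0 • A`
-- must be `{0}`. This is also why (D1) excludes the scalar `0`.
open Classical in
noncomputable instance : SMul S (ConvSubset S M) where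
  smul a A := if h : a = 0 then 0 else ⟨(fun x => a • x) '' A.carrier, isConvex_smul a h A.isConvex⟩

theorem ConvSubset.zero_smul' (A : ConvSubset S M) : (0 : S) • A = 0 := dif_pos rfl

theorem ConvSubset.mem_smul {a : S} (ha : a ≠ 0) {A : ConvSubset S M} {m : M} :
    m ∈ (a • A).carrier ↔ ∃ x ∈ A.carrier, a • x = m := by
  have : a • A = ⟨(fun x => a • x) '' A.carrier, isConvex_smul a ha A.isConvex⟩ := dif_neg ha
  rw [this]
  rfl

theorem ConvSubset.smul_zero' (a : S) : a • (0 : ConvSubset S M) = 0 := by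
  by_cases ha : a = 0
  · rw [ha, zero_smul']
  · ext m
    simp [mem_smul ha, mem_zero, eq_comm]

noncomputable instance : Module S (ConvSubset S M) where
  one_smul A := by
    rcases subsingleton_or_nontrivial S with hS | hS
    · exact ConvSubset.eq_of_subsingleton _ _
    · ext m
      simp [ConvSubset.mem_smul one_ne_zero]
  mul_smul a b A := by
    by_cases ha : a = 0
    · rw [ha, zero_mul, ConvSubset.zero_smul', ConvSubset.zero_smul']
    by_cases hb : b = 0
    · rw [hb, mul_zero, ConvSubset.zero_smul', ConvSubset.smul_zero']
    ext m
    simp [ConvSubset.mem_smul ha, ConvSubset.mem_smul hb,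
      ConvSubset.mem_smul (mul_ne_zero_of_ne ha hb), mul_smul]
  smul_zero := ConvSubset.smul_zero'
  smul_add a A B := by
    by_cases ha : a = 0
    · rw [ha, ConvSubset.zero_smul', ConvSubset.zero_smul', ConvSubset.zero_smul', add_zero]
    ext m
    simp only [ConvSubset.mem_smul ha, ConvSubset.mem_add]
    constructor
    · rintro ⟨_, ⟨x, hx, y, hy, rfl⟩, rfl⟩
      exact ⟨_, ⟨x, hx, rfl⟩, _, ⟨y, hy, rfl⟩, (smul_add _ _ _).symm⟩
    · rintro ⟨_, ⟨x, hx, rfl⟩, _, ⟨y, hy, rfl⟩, rfl⟩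
      exact ⟨_, ⟨x, hx, y, hy, rfl⟩, smul_add _ _ _⟩
  add_smul a b A := by
    by_cases ha : a = 0
    · rw [ha, zero_add, ConvSubset.zero_smul', zero_add]
    by_cases hb : b = 0
    · rw [hb, add_zero, ConvSubset.zero_smul', add_zero]
    have hab : a + b ≠ 0 := fun h => ha (PositiveSemifield.positive _ _ h).1
    obtain ⟨c, h1, h2⟩ := PositiveSemifield.semifield _ hab
    ext m
    simp only [ConvSubset.mem_add, ConvSubset.mem_smul ha, ConvSubset.mem_smul hb,
      ConvSubset.mem_smul hab]
    constructor
    · rintro ⟨x, hx, rfl⟩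
      exact ⟨_, ⟨x, hx, rfl⟩, _, ⟨x, hx, rfl⟩, (add_smul _ _ _).symm⟩
    · rintro ⟨_, ⟨x, hx, rfl⟩, _, ⟨y, hy, rfl⟩, rfl⟩
      -- This inclusion is where convexity of `A` enters: with `c` the inverse of `a + b`, the
      -- element `a • x + b • y` is `a + b` times a convex combination of `x` and `y`.
      refine ⟨_, A.isConvex.add_mem (a := c * a) (b := c * b) (by rw [← mul_add, h2]) hx hy, ?_⟩
      rw [smul_add, smul_smul, smul_smul, ← mul_assoc, ← mul_assoc, h1, one_mul, one_mul]
  zero_smul := ConvSubset.zero_smul'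

/-- Coefficients on the support are nonzero, so each summand `Ω A • A` is a direct image, and an
element of the Minkowski sum amounts to a choice of one element in each `A`. -/
theorem ConvSubset.carrier_combine (Ω : ConvSubset S M →₀ S) :
    (combine S Ω).carrier = alpha S Ω := by
  ext m
  rw [mem_alpha, combine, Finsupp.sum, mem_sum]
  simp only [Finsupp.linearCombination_apply, Finsupp.sum]
  constructor
  · rintro ⟨x, hx, rfl⟩
    have : ∀ A, ∃ y, A ∈ Ω.support → y ∈ A.carrier ∧ Ω A • y = x A := by
      intro A
      by_cases h : A ∈ Ω.support
      · obtain ⟨y, hy⟩ := (mem_smul (Finsupp.mem_support_iff.1 h)).1 (hx A h)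
        exact ⟨y, fun _ => hy⟩
      · exact ⟨0, fun h' => absurd h' h⟩
    choose y hy using this
    exact ⟨y, fun A hA => (hy A hA).1, Finset.sum_congr rfl fun A hA => (hy A hA).2⟩
  · rintro ⟨y, hy, rfl⟩
    exact ⟨fun A => Ω A • y A, fun A hA =>
      (mem_smul (Finsupp.mem_support_iff.1 hA)).2 ⟨_, hy A hA, rfl⟩, rfl⟩

end ConvexModule

/-! ### Semimodules with distributive joins -/

/-- A semimodule that is a complete lattice in which sums and nonzero multiples distribute over
joins. -/
class DistribSup (S : Type u) (A : Type u) [Semiring S] [AddCommMonoid A] [Module S A]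
    [CompleteLattice A] : Prop where
  smul_iSup : ∀ a : S, a ≠ 0 → ∀ {I : Type u} (x : I → A), a • ⨆ i, x i = ⨆ i, a • x i
  iSup_add_iSup : ∀ {I J : Type u} (x : I → A) (y : J → A),
    (⨆ i, x i) + ⨆ j, y j = ⨆ p : I × J, x p.1 + y p.2

/-- A function between such semimodules that respects sums, multiples and joins. -/
structure IsSupLinear (S : Type u) {A B : Type u} [Semiring S] [AddCommMonoid A] [Module S A]
    [CompleteLattice A] [AddCommMonoid B] [Module S B] [CompleteLattice B] (f : A → B) : Prop where
  map_zero : f 0 = 0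
  map_add : ∀ x y, f (x + y) = f x + f y
  map_smul : ∀ (a : S) x, f (a • x) = a • f x
  map_iSup : ∀ {I : Type u} (x : I → A), f (⨆ i, x i) = ⨆ i, f (x i)

theorem IsSupLinear.map_combine {S A B : Type u} [Semiring S] [AddCommMonoid A] [Module S A]
    [CompleteLattice A] [AddCommMonoid B] [Module S B] [CompleteLattice B] {f : A → B}
    (hf : IsSupLinear S f) (φ : A →₀ S) : f (combine S φ) = combine S (φ.mapDomain f) := by
  let g : A →ₗ[S] B := { toFun := f, map_add' := hf.map_add, map_smul' := hf.map_smul }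
  change g _ = _
  rw [combine_eq, combine_eq, Finsupp.linearCombination_mapDomain,
    Finsupp.apply_linearCombination]
  rfl

instance {S M : Type u} [Semiring S] [PositiveSemifield S] [AddCommMonoid M] [Module S M] :
    DistribSup S (ConvSubset S M) where
  smul_iSup a ha I A := by
    obtain ⟨b, hab, hba⟩ := PositiveSemifield.semifield a ha
    have mono : ∀ (c : S) {B C : ConvSubset S M}, c ≠ 0 → B ≤ C → c • B ≤ c • C := by
      intro c B C hc h m hm
      rw [ConvSubset.mem_smul hc] at hm ⊢
      obtain ⟨x, hx, rfl⟩ := hm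
      exact ⟨x, h hx, rfl⟩
    rcases subsingleton_or_nontrivial S with hS | hS
    · exact ConvSubset.eq_of_subsingleton _ _
    have hb : b ≠ 0 := by rintro rfl; simp at hab
    -- Scaling by `a` is left adjoint to scaling by its inverse, hence preserves joins.
    have key : ∀ B C : ConvSubset S M, a • B ≤ C ↔ B ≤ b • C := by
      refine fun B C => ⟨fun h => ?_, fun h => ?_⟩
      · simpa [smul_smul, hba] using mono b hb h
      · simpa [smul_smul, hab] using mono a ha h
    refine eq_of_forall_ge_iff fun C => ?_
    simp only [key, iSup_le_iff]
  iSup_add_iSup A B := by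
    -- Adding `B` also has a right adjoint: the residual set of all `x` with `x + B ⊆ C`, which is
    -- convex because weights that sum to one fix each `y ∈ B`.
    have key : ∀ B C : ConvSubset S M, ∃ D : ConvSubset S M, ∀ A, A + B ≤ C ↔ A ≤ D := by
      intro B C
      refine ⟨⟨{x | ∀ y ∈ B.carrier, x + y ∈ C.carrier}, ?_⟩, fun A => ?_⟩
      · refine isConvex_of_sum_mem fun φ hφ h1 y hy => ?_
        have : ∑ x ∈ φ.support, φ x • x + y = ∑ x ∈ φ.support, φ x • (x + y) := by
          simp only [smul_add, Finset.sum_add_distrib]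
          rw [← Finset.sum_smul, h1, one_smul]
        rw [this]
        exact C.isConvex.sum_mem h1 fun x hx _ => hφ x hx y hy
      · constructor
        · exact fun h x hx y hy => h ⟨x, hx, y, hy, rfl⟩
        · rintro h _ ⟨x, hx, y, hy, rfl⟩
          exact h hx y hy
    have iSup_add_le : ∀ {I : Type u} (A : I → ConvSubset S M) (B C : ConvSubset S M),
        (⨆ i, A i) + B ≤ C ↔ ∀ i, A i + B ≤ C := by
      intro I A B C
      obtain ⟨D, hD⟩ := key B C
      simp only [hD, iSup_le_iff]
    refine eq_of_forall_ge_iff fun C => ?_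
    rw [iSup_add_le, iSup_le_iff, Prod.forall]
    refine forall_congr' fun i => ?_
    rw [add_comm, iSup_add_le]
    simp only [add_comm]

theorem isSupLinear_mapConv {S X Y : Type u} [Semiring S] [PositiveSemifield S] (f : X → Y) :
    IsSupLinear S (mapConv f : ConvPow S X → ConvPow S Y) where
  map_zero := by
    ext1
    change _ '' {0} = {0}
    simp
  map_add A B := by
    ext m
    constructor
    · rintro ⟨_, ⟨x, hx, y, hy, rfl⟩, rfl⟩
      exact ⟨_, ⟨x, hx, rfl⟩, _, ⟨y, hy, rfl⟩, Finsupp.mapDomain_add.symm⟩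
    · rintro ⟨_, ⟨x, hx, rfl⟩, _, ⟨y, hy, rfl⟩, rfl⟩
      exact ⟨_, ⟨x, hx, y, hy, rfl⟩, Finsupp.mapDomain_add⟩
  map_smul a A := by
    by_cases ha : a = 0
    · rw [ha, zero_smul, zero_smul]
      ext1
      change _ '' {0} = {0}
      simp
    ext m
    rw [ConvSubset.mem_smul ha]
    constructor
    · rintro ⟨_, hax, rfl⟩
      obtain ⟨x, hx, rfl⟩ := (ConvSubset.mem_smul ha).1 hax
      exact ⟨_, ⟨x, hx, rfl⟩, (Finsupp.mapDomain_smul _ _).symm⟩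
    · rintro ⟨_, ⟨x, hx, rfl⟩, rfl⟩
      exact ⟨_, (ConvSubset.mem_smul ha).2 ⟨x, hx, rfl⟩, Finsupp.mapDomain_smul _ _⟩
  map_iSup A := by
    -- Direct image is left adjoint to preimage, and preimages of convex sets under linear maps are
    -- convex.
    have key : ∀ (A : ConvPow S X) (B : ConvPow S Y), mapConv f A ≤ B ↔
        A ≤ ⟨_, B.isConvex.preimage (Finsupp.lmapDomain S S f)⟩ := fun A B =>
      Set.image_subset_iff
    refine eq_of_forall_ge_iff fun B => ?_
    simp only [key, iSup_le_iff]

/-! ### The structure map -/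

section Extend

variable {S A : Type u} [Semiring S] [AddCommMonoid A] [Module S A] [CompleteLattice A]

/-- The join of the values of all linear combinations in a convex set. -/
noncomputable def extend (C : ConvPow S A) : A := ⨆ φ : C.carrier, combine S φ.1

theorem extend_le_iff {C : ConvPow S A} {t : A} :
    extend C ≤ t ↔ ∀ φ ∈ C.carrier, combine S φ ≤ t := by
  rw [extend, iSup_le_iff, Subtype.forall]

theorem extend_singleton {C : ConvPow S A} {φ : A →₀ S} (h : C.carrier = {φ}) :
    extend C = combine S φ := by
  refine eq_of_forall_ge_iff fun t => ?_
  rw [extend_le_iff, h]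
  simp

theorem extend_unitConv (x : A) : extend (unitConv x : ConvPow S A) = x := by
  rw [extend_singleton rfl, combine_eq]
  simp

theorem IsSupLinear.map_extend {B : Type u} [AddCommMonoid B] [Module S B] [CompleteLattice B]
    {f : A → B} (hf : IsSupLinear S f) (C : ConvPow S A) : f (extend C) = extend (mapConv f C) := by
  rw [extend, hf.map_iSup]
  refine eq_of_forall_ge_iff fun t => ?_
  rw [extend_le_iff, iSup_le_iff]
  simp [mapConv, hf.map_combine]

/-- By `ConvSubset.carrier_combine` the sets being joined are the `alpha S Ω`. Their union is
already convex since `𝒜` is, so taking the hull adds nothing. -/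
theorem extend_eq_multConv [PositiveSemifield S] {X : Type u} (𝒜 : ConvPow S (ConvPow S X)) :
    extend 𝒜 = multConv 𝒜 := by
  have : (⋃ Ω : 𝒜.carrier, (combine S Ω.1).carrier) = (multConv 𝒜).carrier := by
    simp [ConvSubset.carrier_combine, multConv]
  ext1
  rw [extend, ConvSubset.carrier_iSup_of_isConvex, this]
  rw [this]
  exact (multConv 𝒜).isConvex

-- Distributivity over two-element joins implies monotonicity: `x'` is the join of `x` and `x'`, and
-- `x + y` is one of the terms of the expanded sum. The index type is lifted because the laws
-- quantify over index types in universe `u`.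
variable (S) in
theorem add_mono_of_distribSup [DistribSup S A] {x x' y y' : A} (hx : x ≤ x') (hy : y ≤ y') :
    x + y ≤ x' + y' := by
  have sup_eq : ∀ {z z' : A}, z ≤ z' → ⨆ b : ULift.{u} Bool, (bif b.down then z else z') = z' := by
    intro z z' h
    apply le_antisymm
    · exact iSup_le fun ⟨b⟩ => by cases b <;> simp [h]
    · exact le_iSup (fun b : ULift.{u} Bool => bif b.down then z else z') ⟨false⟩
  rw [← sup_eq hx, ← sup_eq hy, DistribSup.iSup_add_iSup (S := S)]
  exact le_iSup (fun p : ULift.{u} Bool × ULift.{u} Bool =>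
    (bif p.1.down then x else x') + bif p.2.down then y else y') (⟨true⟩, ⟨true⟩)

variable [DistribSup S A]

theorem smul_mono_of_distribSup (a : S) {x x' : A} (hx : x ≤ x') : a • x ≤ a • x' := by
  by_cases ha : a = 0
  · simp [ha]
  have sup_eq : ⨆ b : ULift.{u} Bool, (bif b.down then x else x') = x' := by
    apply le_antisymm
    · exact iSup_le fun ⟨b⟩ => by cases b <;> simp [hx]
    · exact le_iSup (fun b : ULift.{u} Bool => bif b.down then x else x') ⟨false⟩
  rw [← sup_eq, DistribSup.smul_iSup a ha]
  exact le_iSup (fun b : ULift.{u} Bool => a • bif b.down then x else x') ⟨true⟩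

/-- By monotonicity, a combination of elements below `t` is at most the same combination of copies
of `t`, which is `1 • t`. -/
theorem isConvex_Iic (t : A) : IsConvex S (Set.Iic t) := by
  classical
  refine isConvex_of_sum_mem fun φ hφ h1 => ?_
  have : ∀ s ⊆ φ.support, ∑ x ∈ s, φ x • x ≤ ∑ x ∈ s, φ x • t := by
    intro s
    induction s using Finset.induction_on with
    | empty => simp
    | insert j s hj ih =>
      intro hs
      rw [Finset.sum_insert hj, Finset.sum_insert hj]
      exact add_mono_of_distribSup S
        (smul_mono_of_distribSup _ (hφ j (hs (Finset.mem_insert_self _ _))))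
        (ih ((Finset.subset_insert _ _).trans hs))
  have h := this _ subset_rfl
  rwa [← Finset.sum_smul, h1, one_smul] at h

theorem isSupLinear_extend [PositiveSemifield S] :
    IsSupLinear S (extend : ConvPow S A → A) where
  map_zero := by
    rw [extend_singleton rfl, combine_eq, map_zero]
  map_add C D := by
    change extend (C + D) = (⨆ φ : C.carrier, combine S φ.1) + ⨆ φ : D.carrier, combine S φ.1
    rw [DistribSup.iSup_add_iSup (S := S)]
    refine eq_of_forall_ge_iff fun t => ?_
    rw [extend_le_iff, iSup_le_iff]
    constructor
    · rintro h ⟨⟨x, hx⟩, y, hy⟩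
      simpa [combine_eq] using h _ ⟨x, hx, y, hy, rfl⟩
    · rintro h _ ⟨x, hx, y, hy, rfl⟩
      simpa [combine_eq] using h ⟨⟨x, hx⟩, y, hy⟩
  map_smul a C := by
    by_cases ha : a = 0
    · rw [ha, zero_smul, zero_smul, extend_singleton rfl, combine_eq, map_zero]
    change extend (a • C) = a • ⨆ φ : C.carrier, combine S φ.1
    rw [DistribSup.smul_iSup a ha]
    refine eq_of_forall_ge_iff fun t => ?_
    rw [extend_le_iff, iSup_le_iff]
    constructor
    · rintro h ⟨x, hx⟩
      simpa [combine_eq] using h _ ((ConvSubset.mem_smul ha).2 ⟨x, hx, rfl⟩)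
    · intro h _ hax
      obtain ⟨x, hx, rfl⟩ := (ConvSubset.mem_smul ha).1 hax
      simpa [combine_eq] using h ⟨x, hx⟩
  map_iSup C := by
    -- Evaluation has a right adjoint, sending `t` to the formal combinations with value below `t`.
    -- That set is convex by `isConvex_Iic`, so passing to the hull of a union does not change the
    -- join.
    have key : ∀ (C : ConvPow S A) (t : A), extend C ≤ t ↔
        C ≤ ⟨_, (isConvex_Iic t).preimage (Finsupp.linearCombination S id)⟩ := fun C t => by
      rw [extend_le_iff]
      simp only [combine_eq]
      rfl
    refine eq_of_forall_ge_iff fun t => ?_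
    simp only [key, iSup_le_iff]

/-- The Eilenberg–Moore associativity law is the statement that the homomorphism `extend` commutes
with evaluation. -/
theorem extend_multConv [PositiveSemifield S] (𝒜 : ConvPow S (ConvPow S A)) :
    extend (multConv 𝒜) = extend (mapConv extend 𝒜) := by
  rw [← extend_eq_multConv, isSupLinear_extend.map_extend]

end Extend

/-! ### Evaluation of terms -/

section Eval

variable {S V A : Type u} (ops : ∀ o : ConvOp S, ((convSig S).Arity o → A) → A) (val : V → A)

theorem eval_tVar (x : V) : (tVar x : Term (convSig S) V).eval ops val = val x := rfl

theorem eval_tJoin (I : Type u) (t : I → Term (convSig S) V) :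
    (tJoin I t).eval ops val = ops (.join I) fun i => (t i).eval ops val := rfl

theorem eval_tAdd (s t : Term (convSig S) V) : (tAdd s t).eval ops val =
    ops .add fun b => bif b.down then t.eval ops val else s.eval ops val := by
  change ops .add _ = _
  congr 1
  funext ⟨b⟩
  cases b <;> rfl

theorem eval_tZero : (tZero : Term (convSig S) V).eval ops val = ops .zero fun e => e.elim := by
  change ops .zero _ = _
  congr 1
  funext e
  exact e.elim

theorem eval_tSmul (a : S) (t : Term (convSig S) V) :
    (tSmul a t).eval ops val = ops (.smul a) fun _ => t.eval ops val := rfl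

end Eval

theorem Term.map_eval {Sg : Signature.{u}} {V A B : Type u}
    {opsA : ∀ o : Sg.Op, (Sg.Arity o → A) → A} {opsB : ∀ o : Sg.Op, (Sg.Arity o → B) → B}
    {f : A → B} (hf : ∀ o x, f (opsA o x) = opsB o fun i => f (x i)) (val : V → A)
    (t : Term Sg V) : f (t.eval opsA val) = t.eval opsB fun v => f (val v) := by
  induction t with
  | var x => rfl
  | op o ts ih =>
    change f (opsA o _) = opsB o _
    rw [hf]
    exact congrArg (opsB o) (funext ih)

/-! ### Semimodules with distributive joins as algebras for the theory -/

section OfModule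

variable {S : Type u} [Semiring S]

variable (S) in
/-- The operations of the theory on a semimodule that is a complete lattice. -/
def moduleOps (A : Type u) [AddCommMonoid A] [Module S A] [CompleteLattice A] :
    ∀ o : ConvOp S, ((convSig S).Arity o → A) → A
  | .join _, x => iSup x
  | .add, x => x ⟨false⟩ + x ⟨true⟩
  | .zero, _ => 0
  | .smul a, x => a • x PUnit.unit

theorem moduleOps_sat (A : Type u) [AddCommMonoid A] [Module S A] [CompleteLattice A]
    [DistribSup S A] (e : Equation (convSig S)) (he : e ∈ (convTheory S).eqns)
    (val : e.Vars → A) : e.lhs.eval (moduleOps S A) val = e.rhs.eval (moduleOps S A) val := by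
  rcases he with (he | he) | he
  · cases he with
    | singleton =>
      change ⨆ i : PUnit.{u + 1}, val i = val PUnit.unit
      simp
    | reindex f hf =>
      exact (hf.iSup_comp val).symm
    | @assoc I J f =>
      change ⨆ i : I, val i = ⨆ j : J, ⨆ i : {i : I // f i = j}, val i.1
      refine eq_of_forall_ge_iff fun t => ?_
      simp only [iSup_le_iff, Subtype.forall]
      exact ⟨fun h _ i _ => h i, fun h i => h _ i rfl⟩
  · cases he <;> simp only [eval_tAdd, eval_tZero, eval_tSmul, eval_tVar, moduleOps, cond_true,
      cond_false]
    · exact add_assoc _ _ _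
    · exact add_comm _ _
    · exact add_zero _
    · exact smul_zero _
    · exact zero_smul _ _
    · exact one_smul _ _
    · exact mul_smul _ _ _
    · exact smul_add _ _ _
    · exact add_smul _ _ _
  · cases he with
    | smul_join a ha I =>
      exact DistribSup.smul_iSup a ha _
    | add_join I J =>
      simp only [eval_tJoin, eval_tAdd, eval_tVar, moduleOps, cond_true, cond_false]
      exact DistribSup.iSup_add_iSup (S := S) _ _

theorem IsSupLinear.map_moduleOps {A B : Type u} [AddCommMonoid A] [Module S A]
    [CompleteLattice A] [AddCommMonoid B] [Module S B] [CompleteLattice B] {f : A → B}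
    (hf : IsSupLinear S f) (o : ConvOp S) (x : (convSig S).Arity o → A) :
    f (moduleOps S A o x) = moduleOps S B o fun i => f (x i) := by
  cases o with
  | join I => exact hf.map_iSup x
  | add => exact hf.map_add _ _
  | zero => exact hf.map_zero
  | smul a => exact hf.map_smul _ _

end OfModule

/-! ### The structure carried by an algebra for the theory -/

namespace Structure

variable {S : Type u} [Semiring S] (B : (convTheory S).Alg)

/-- The sum of two elements. -/
def add (x y : B.carrier) : B.carrier :=
  B.ops ConvOp.add fun b : ULift.{u} Bool => bif b.down then y else x

/-- The zero element. -/
def zero : B.carrier := B.ops ConvOp.zero fun e : PEmpty.{u + 1} => e.elim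

/-- Scalar multiples. -/
def smul (a : S) (x : B.carrier) : B.carrier :=
  B.ops (ConvOp.smul a) fun _ : PUnit.{u + 1} => x

/-- Joins of families. -/
def join {I : Type u} (x : I → B.carrier) : B.carrier := B.ops (ConvOp.join I) x

theorem sat_semimodule {e : Equation (convSig S)} (he : SemimoduleAxiom S e)
    (val : e.Vars → B.carrier) : e.lhs.eval B.ops val = e.rhs.eval B.ops val :=
  B.sat e (Or.inl (Or.inr he)) val

theorem sat_semilattice {e : Equation (convSig S)} (he : SemilatticeAxiom S e)
    (val : e.Vars → B.carrier) : e.lhs.eval B.ops val = e.rhs.eval B.ops val :=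
  B.sat e (Or.inl (Or.inl he)) val

theorem sat_distrib {e : Equation (convSig S)} (he : DistribAxiom S e)
    (val : e.Vars → B.carrier) : e.lhs.eval B.ops val = e.rhs.eval B.ops val :=
  B.sat e (Or.inr he) val

theorem eval_add {V : Type u} (val : V → B.carrier) (s t : Term (convSig S) V) :
    (tAdd s t).eval B.ops val = add B (s.eval B.ops val) (t.eval B.ops val) :=
  eval_tAdd (S := S) B.ops val s t

theorem eval_zero {V : Type u} (val : V → B.carrier) :
    (tZero : Term (convSig S) V).eval B.ops val = zero B :=
  eval_tZero (S := S) B.ops val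

theorem eval_smul {V : Type u} (val : V → B.carrier) (a : S) (t : Term (convSig S) V) :
    (tSmul a t).eval B.ops val = smul B a (t.eval B.ops val) := rfl

theorem eval_join {V : Type u} (val : V → B.carrier) (I : Type u) (t : I → Term (convSig S) V) :
    (tJoin I t).eval B.ops val = join B fun i => (t i).eval B.ops val := rfl

theorem eval_var {V : Type u} (val : V → B.carrier) (x : V) :
    (tVar x : Term (convSig S) V).eval B.ops val = val x := rfl

/-- The valuation of the variables of the semimodule axioms by three given elements. -/
def val3 (x y z : B.carrier) (i : ULift.{u} (Fin 3)) : B.carrier := ![x, y, z] i.down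

instance : AddCommMonoid B.carrier where
  add := add B
  zero := zero B
  nsmul := @nsmulRec _ ⟨zero B⟩ ⟨add B⟩
  add_assoc x y z := by
    have h := sat_semimodule B .add_assoc (val3 B x y z)
    simp only [eval_add, eval_var] at h
    exact h
  add_comm x y := by
    have h := sat_semimodule B .add_comm (val3 B x y x)
    simp only [eval_add, eval_var] at h
    exact h
  zero_add x := by
    have h := sat_semimodule B .add_zero (val3 B x x x)
    have h' := sat_semimodule B .add_comm (val3 B (zero B) x x)
    simp only [eval_add, eval_zero, eval_var] at h h'
    exact h'.trans h
  add_zero x := by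
    have h := sat_semimodule B .add_zero (val3 B x x x)
    simp only [eval_add, eval_zero, eval_var] at h
    exact h

instance : Module S B.carrier where
  smul := smul B
  one_smul x := by
    have h := sat_semimodule B .one_smul (val3 B x x x)
    simp only [eval_smul, eval_var] at h
    exact h
  mul_smul a b x := by
    have h := sat_semimodule B (.mul_smul a b) (val3 B x x x)
    simp only [eval_smul, eval_var] at h
    exact h
  smul_zero a := by
    have h := sat_semimodule B (.smul_zero a) (val3 B (zero B) (zero B) (zero B))
    simp only [eval_smul, eval_zero] at h
    exact h
  smul_add a x y := by
    have h := sat_semimodule B (.smul_add a) (val3 B x y x)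
    simp only [eval_smul, eval_add, eval_var] at h
    exact h
  add_smul a b x := by
    have h := sat_semimodule B (.add_smul a b) (val3 B x x x)
    simp only [eval_smul, eval_add, eval_var] at h
    exact h
  zero_smul x := by
    have h := sat_semimodule B .zero_smul (val3 B x x x)
    simp only [eval_smul, eval_zero, eval_var] at h
    exact h

/-- The join of a set of elements. -/
def joinSet (s : Set B.carrier) : B.carrier := join B fun x : s => x.1

/-- Reindexing along the surjection onto the range shows that a join depends only on the set of its
members. -/
theorem join_eq_joinSet {I : Type u} (x : I → B.carrier) : join B x = joinSet B (Set.range x) := by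
  have h := sat_semilattice B (.reindex (Set.rangeFactorization x)
    Set.rangeFactorization_surjective) Subtype.val
  simp only [eval_join, eval_var] at h
  exact h.symm

theorem joinSet_singleton (x : B.carrier) : joinSet B {x} = x := by
  have h := sat_semilattice B .singleton fun _ => x
  simp only [eval_join, eval_var] at h
  rw [join_eq_joinSet, Set.range_const] at h
  exact h

theorem joinSet_iUnion {J : Type u} (s : J → Set B.carrier) :
    joinSet B (⋃ j, s j) = join B fun j => joinSet B (s j) := by
  -- The disjoint union is used because the `s j` may overlap; its fibre over `j` is a copy of `s
  -- j`.
  have h := sat_semilattice B (.assoc (Sigma.fst : (Σ j, s j) → J)) fun p => p.2.1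
  simp only [eval_join, eval_var] at h
  rw [join_eq_joinSet] at h
  convert h using 2
  · ext y
    simp
  · funext j
    rw [join_eq_joinSet]
    congr 1
    ext y
    constructor
    · intro hy
      exact ⟨⟨⟨j, y, hy⟩, rfl⟩, rfl⟩
    · rintro ⟨⟨⟨_, y, hy⟩, rfl⟩, rfl⟩
      exact hy

theorem joinSet_union (s t : Set B.carrier) :
    joinSet B (s ∪ t) = joinSet B {joinSet B s, joinSet B t} := by
  have h := joinSet_iUnion B fun b : ULift.{u} Bool => bif b.down then s else t
  rw [join_eq_joinSet] at h
  convert h using 2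
  · ext y
    simp [or_comm]
  · ext y
    simp [or_comm, eq_comm]

instance : PartialOrder B.carrier where
  le x y := joinSet B {x, y} = y
  le_refl x := by rw [Set.pair_eq_singleton, joinSet_singleton]
  le_antisymm x y hxy hyx := by rw [← hxy, Set.pair_comm, hyx]
  le_trans x y z hxy hyz := by
    have h1 := joinSet_union B {x} {y, z}
    have h2 := joinSet_union B {x, y} {z}
    have e : ({x} ∪ {y, z} : Set B.carrier) = {x, y} ∪ {z} := by
      ext w
      simp only [Set.mem_union, Set.mem_insert_iff, Set.mem_singleton_iff, or_assoc]
    rw [joinSet_singleton, hyz] at h1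
    rw [joinSet_singleton, hxy, hyz] at h2
    rw [← h1, e, h2]

instance : SupSet B.carrier := ⟨joinSet B⟩

instance : CompleteLattice B.carrier :=
  completeLatticeOfSup _ fun s => by
    refine ⟨fun x hx => ?_, fun t ht => ?_⟩
    · have h := joinSet_union B {x} s
      rw [joinSet_singleton, Set.singleton_union, Set.insert_eq_of_mem hx] at h
      exact h.symm
    · have h := joinSet_iUnion B fun x : ↥(insert t s) => ({x.1, t} : Set B.carrier)
      have e : (⋃ x : ↥(insert t s), ({x.1, t} : Set B.carrier)) = s ∪ {t} := by
        ext y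
        simp only [Set.mem_iUnion, Set.mem_insert_iff, Set.mem_singleton_iff, Subtype.exists,
          Set.mem_union]
        grind
      have e' : (fun x : ↥(insert t s) => joinSet B {x.1, t}) = fun _ => t := by
        funext ⟨x, hx⟩
        rcases hx with rfl | hx
        · rw [Set.pair_eq_singleton, joinSet_singleton]
        · exact ht hx
      have : Nonempty ↥(insert t s) := ⟨⟨t, Set.mem_insert _ _⟩⟩
      rw [e, e', join_eq_joinSet, Set.range_const, joinSet_union, joinSet_singleton] at h
      exact h

theorem iSup_eq_join {I : Type u} (x : I → B.carrier) : ⨆ i, x i = join B x :=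
  (join_eq_joinSet B x).symm

instance : DistribSup S B.carrier where
  smul_iSup a ha I x := by
    have h := sat_distrib B (.smul_join a ha I) x
    simp only [eval_join, eval_smul, eval_var] at h
    rw [iSup_eq_join, iSup_eq_join]
    exact h
  iSup_add_iSup {I J} x y := by
    have h := sat_distrib B (.add_join I J) (Sum.elim x y)
    simp only [eval_join, eval_add, eval_var] at h
    rw [iSup_eq_join, iSup_eq_join, iSup_eq_join]
    exact h

theorem moduleOps_eq (o : ConvOp S) (x : (convSig S).Arity o → B.carrier) :
    moduleOps S B.carrier o x = B.ops o x := by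
  cases o with
  | join I => exact iSup_eq_join B x
  | add =>
    change B.ops ConvOp.add _ = _
    congr 1
    funext ⟨b⟩
    cases b <;> rfl
  | zero =>
    change B.ops ConvOp.zero _ = _
    congr 1
    funext e
    exact e.elim
  | smul a => rfl

theorem isSupLinear_of_hom {B B' : (convTheory S).Alg} (f : AlgebraicTheory.Alg.Hom B B') :
    IsSupLinear S f.toFun := by
  have h : ∀ (o : ConvOp S) (x : (convSig S).Arity o → B.carrier),
      f.toFun (moduleOps S B.carrier o x) = moduleOps S B'.carrier o fun i => f.toFun (x i) := by
    intro o x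
    rw [moduleOps_eq, moduleOps_eq]
    exact f.map_ops o x
  exact
    { map_zero := h .zero fun e => e.elim
      map_add := fun x y => h .add fun b => bif b.down then y else x
      map_smul := fun a x => h (.smul a) fun _ => x
      map_iSup := fun {I} x => h (.join I) x }

end Structure

/-! ### The isomorphism of categories -/

section Iso

variable {S : Type u} [Semiring S] [PositiveSemifield S]

/-- The structure map of an Eilenberg-Moore algebra as a function. -/
def structureMap (E : (convMonad S).Algebra) (C : ConvPow S E.A) : E.A := E.a C

theorem structureMap_unitConv (E : (convMonad S).Algebra) (x : E.A) :
    structureMap E (unitConv x) = x :=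
  ConcreteCategory.congr_hom E.unit x

theorem structureMap_multConv (E : (convMonad S).Algebra) (𝒜 : ConvPow S (ConvPow S E.A)) :
    structureMap E (multConv 𝒜) = structureMap E (mapConv (structureMap E) 𝒜) :=
  ConcreteCategory.congr_hom E.assoc 𝒜

theorem structureMap_hom {E E' : (convMonad S).Algebra} (f : E ⟶ E') (C : ConvPow S E.A) :
    structureMap E' (mapConv f.f C) = f.f (structureMap E C) :=
  ConcreteCategory.congr_hom f.h C

/-- The operations of the theory on an Eilenberg-Moore algebra. -/
noncomputable def algebraOps (E : (convMonad S).Algebra) (o : ConvOp S)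
    (x : (convSig S).Arity o → E.A) : E.A :=
  structureMap E (moduleOps S (ConvPow S E.A) o fun i => unitConv (x i))

/-- The structure map is a homomorphism. Since `multConv` is the homomorphism `extend`, the
operation applied to the `C i` is `multConv` of the operation applied to their units. Associativity
replaces `multConv` by `mapConv (structureMap E)`, which is again a homomorphism and commutes with
the units. -/
theorem structureMap_moduleOps (E : (convMonad S).Algebra) (o : ConvOp S)
    (C : (convSig S).Arity o → ConvPow S E.A) :
    structureMap E (moduleOps S (ConvPow S E.A) o C) =
      algebraOps E o fun i => structureMap E (C i) := by
  have h : moduleOps S (ConvPow S E.A) o C =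
      multConv (moduleOps S (ConvPow S (ConvPow S E.A)) o fun i => unitConv (C i)) := by
    rw [← extend_eq_multConv, isSupLinear_extend.map_moduleOps]
    simp only [extend_unitConv]
  rw [h, structureMap_multConv, (isSupLinear_mapConv _).map_moduleOps]
  simp only [mapConv_unit]
  rfl

theorem map_algebraOps {E E' : (convMonad S).Algebra} (f : E ⟶ E') (o : ConvOp S)
    (x : (convSig S).Arity o → E.A) :
    f.f (algebraOps E o x) = algebraOps E' o fun i => f.f (x i) := by
  unfold algebraOps
  rw [← structureMap_hom, (isSupLinear_mapConv _).map_moduleOps]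
  simp only [mapConv_unit]

/-- The algebra for the theory that is given by an Eilenberg-Moore algebra. -/
noncomputable def algOfAlgebra (E : (convMonad S).Algebra) : (convTheory S).Alg where
  carrier := E.A
  ops := algebraOps E
  sat e he val := by
    -- The equation holds in `ConvPow S E.A` at the units of the values, and the structure map
    -- carries it down to `E.A`.
    have h := congrArg (structureMap E)
      (moduleOps_sat (ConvPow S E.A) e he fun v => unitConv (val v))
    have key : ∀ t : Term (convSig S) e.Vars,
        structureMap E (t.eval (moduleOps S (ConvPow S E.A)) fun v => unitConv (val v)) =
          t.eval (algebraOps E) val := fun t => by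
      refine (Term.map_eval (Sg := convSig S) (structureMap_moduleOps E) _ t).trans ?_
      simp only [structureMap_unitConv]
    exact (key _).symm.trans (h.trans (key _))

variable (S) in
/-- Eilenberg-Moore algebras are algebras for the theory. -/
noncomputable def toAlg : (convMonad S).Algebra ⥤ (convTheory S).Alg where
  obj := algOfAlgebra
  map {E E'} f :=
    { toFun := f.f
      map_ops := fun o x => by
        change f.f (algebraOps E o x) = algebraOps E' o _
        exact map_algebraOps f o x }

/-- The Eilenberg-Moore algebra that is given by an algebra for the theory. -/
noncomputable def algebraOfAlg (B : (convTheory S).Alg) : (convMonad S).Algebra where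
  A := B.carrier
  a := ↾(extend : ConvPow S B.carrier → B.carrier)
  unit := by apply ConcreteCategory.hom_ext; exact extend_unitConv (S := S) (A := B.carrier)
  assoc := by apply ConcreteCategory.hom_ext; exact extend_multConv (S := S) (A := B.carrier)

variable (S) in
/-- Algebras for the theory are Eilenberg-Moore algebras. -/
noncomputable def ofAlg : (convTheory S).Alg ⥤ (convMonad S).Algebra where
  obj := algebraOfAlg
  map {B B'} f :=
    { f := ↾f.toFun
      h := by
        apply ConcreteCategory.hom_ext
        intro C
        exact ((Structure.isSupLinear_of_hom f).map_extend C).symm }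

theorem algebraOps_algebraOfAlg (B : (convTheory S).Alg) (o : ConvOp S)
    (x : (convSig S).Arity o → B.carrier) : algebraOps (algebraOfAlg B) o x = B.ops o x := by
  refine ((isSupLinear_extend (S := S) (A := B.carrier)).map_moduleOps o _).trans ?_
  refine (Structure.moduleOps_eq B o _).trans (congrArg (B.ops o) (funext fun i => ?_))
  exact extend_unitConv _

/-- With the carrier fixed, equality of algebras reduces to equality of operations, with no
transport along equalities of types. -/
theorem Alg.mk_congr {T : AlgebraicTheory.{u}} {A : Type u}
    {ops ops' : ∀ o : T.sig.Op, (T.sig.Arity o → A) → A} {h h'} (e : ops = ops') :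
    (⟨A, ops, h⟩ : T.Alg) = ⟨A, ops', h'⟩ := by
  subst e
  rfl

theorem algOfAlgebra_algebraOfAlg (B : (convTheory S).Alg) :
    algOfAlgebra (algebraOfAlg B) = B := by
  have h : algebraOps (algebraOfAlg B) = B.ops := by
    funext o x
    exact algebraOps_algebraOfAlg B o x
  change (⟨B.carrier, algebraOps (algebraOfAlg B), _⟩ : (convTheory S).Alg) =
    ⟨B.carrier, B.ops, B.sat⟩
  exact Alg.mk_congr h

/-- The codomain is written `(algOfAlgebra E).carrier`, which unfolds to `E.A`, so that it carries
the order and semimodule structure derived from the operations. -/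
theorem isSupLinear_structureMap (E : (convMonad S).Algebra) :
    IsSupLinear S (B := (algOfAlgebra E).carrier) (structureMap E) := by
  have h : ∀ (o : ConvOp S) (C : (convSig S).Arity o → ConvPow S E.A),
      structureMap E (moduleOps S (ConvPow S E.A) o C) =
        moduleOps S (algOfAlgebra E).carrier o fun i => structureMap E (C i) := by
    intro o C
    exact (structureMap_moduleOps E o C).trans
      (Structure.moduleOps_eq (algOfAlgebra E) o _).symm
  exact
    { map_zero := h .zero fun e => e.elim
      map_add := fun x y => h .add fun b => bif b.down then y else x
      map_smul := fun a x => h (.smul a) fun _ => x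
      map_iSup := fun {I} x => h (.join I) x }

/-- As a homomorphism, the structure map commutes with evaluation, and evaluation of convex sets is
`multConv`; so both sides agree on every `mapConv (structureMap E) 𝒜`. Every `C` has this form, with
`𝒜 = mapConv unitConv C`, because the unit is a section of the structure map. -/
theorem extend_algOfAlgebra (E : (convMonad S).Algebra)
    (C : ConvPow S (algOfAlgebra E).carrier) : extend C = structureMap E C := by
  have h : ∀ 𝒜 : ConvPow S (ConvPow S E.A),
      extend (A := (algOfAlgebra E).carrier) (mapConv (structureMap E) 𝒜) =
        structureMap E (mapConv (structureMap E) 𝒜) := fun 𝒜 => by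
    rw [← structureMap_multConv, ← extend_eq_multConv]
    exact ((isSupLinear_structureMap E).map_extend 𝒜).symm
  have e : ∀ C : ConvPow S E.A, mapConv (structureMap E) (mapConv unitConv C) = C := fun C => by
    rw [← mapConv_comp, show structureMap E ∘ unitConv = id from
      funext (structureMap_unitConv E)]
    exact mapConv_id C
  exact Eq.subst (motive := fun C => extend (A := (algOfAlgebra E).carrier) C = structureMap E C)
    (e C) (h (mapConv unitConv C))

theorem Algebra.mk_congr {T : Monad (Type u)} {A : Type u} {a a' : (T : Type u ⥤ Type u).obj A ⟶ A}
    {h₁ h₂ h₁' h₂'} (e : a = a') : (⟨A, a, h₁, h₂⟩ : T.Algebra) = ⟨A, a', h₁', h₂'⟩ := by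
  subst e
  rfl

theorem algebraOfAlg_algOfAlgebra (E : (convMonad S).Algebra) :
    algebraOfAlg (algOfAlgebra E) = E := by
  have h : (algebraOfAlg (algOfAlgebra E)).a = E.a := by
    apply ConcreteCategory.hom_ext
    exact extend_algOfAlgebra E
  change (⟨E.A, (algebraOfAlg (algOfAlgebra E)).a, _, _⟩ : (convMonad S).Algebra) =
    ⟨E.A, E.a, E.unit, E.assoc⟩
  exact Algebra.mk_congr h

instance (T : AlgebraicTheory.{u}) : T.forget.Faithful where
  map_injective h := AlgebraicTheory.Alg.Hom.ext (funext (ConcreteCategory.congr_hom h))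

/-- Equality of functors on morphisms involves transports along the object equalities. Applying the
faithful `U` moves them into the category of sets, where the equality `H ⋙ U = U` already accounts
for them. For both round trips that equality holds by definition. -/
theorem functor_eq_id_of_comp_faithful {C D : Type*} [Category* C] [Category* D] (U : C ⥤ D)
    [U.Faithful] (H : C ⥤ C) (hobj : ∀ X, H.obj X = X) (hU : H ⋙ U = U) : H = 𝟭 C := by
  refine CategoryTheory.Functor.ext hobj fun X Y f => U.map_injective ?_
  have h := Functor.congr_hom hU f
  rw [Functor.map_comp, Functor.map_comp, eqToHom_map, eqToHom_map]
  exact h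

end Iso

end ConvexPowerset

theorem mainTheorem3 (S : Type u) [Semiring S] [ConvexPowerset.PositiveSemifield S] :
    (ConvexPowerset.convTheory S).Presents (ConvexPowerset.convMonad S) :=
  ⟨ConvexPowerset.toAlg S, ConvexPowerset.ofAlg S,
    ConvexPowerset.functor_eq_id_of_comp_faithful (ConvexPowerset.convMonad S).forget _
      ConvexPowerset.algebraOfAlg_algOfAlgebra rfl,
    ConvexPowerset.functor_eq_id_of_comp_faithful (ConvexPowerset.convTheory S).forget _
      ConvexPowerset.algOfAlgebra_algebraOfAlg rfl, rfl⟩
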